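/- **Setting.** Let $\mathcal X$ be an infinite-dimensional separable real Hilbert space. Let $\mathcal C_0$ be a self-adjoint, positive-definite, trace class operator on $\mathcal X$ with orthonormal eigenbasis $(\phi_k)_{k\in\mathbb N}$. For $t\in\mathbb R$ let $\|u\|_t=\|\mathcal C_0^{-t/2}u\|$ and let $X^t$ be the associated Hilbert scale, that is, the completion of $\bigcap_{l\ge 0}\mathcal D(\mathcal C_0^{-l})$ in $\|\cdot\|_t$ (identified with the space of sequences of coefficients in $(\phi_k)$ for which this norm is finite; put $\|u\|_t=\infty$ for $u\notin X^t$). Let $\mathcal C_1$ be a bounded, self-adjoint, positive-definite operator on $\mathcal X$, and let $\mathcal A$ be a self-adjoint, positive-definite (generally unbounded) operator in $\mathcal X$ with bounded inverse $\mathcal A^{-1}$. **Assumptions.** There are $s_0\in[0,1)$, $\beta\ge 0$, $\ell\ge 0$ and positive constants $c,c',c_1,\dots,c_4$ such that 1. $\mathcal C_0^s$ is trace class for all $s>s_0$; 2. $\Delta:=2\ell-\beta+1>2s_0$; 3. $c\,\|u\|_{\beta-2\ell}\le\|\mathcal C_1^{-1/2}\mathcal A^{-1}u\|\le c'\|u\|_{\beta-2\ell}$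 for all $u\in X^{\beta-2\ell}$; 4. $\|\mathcal C_1^{1/2}u\|_{\rho}\le c_1\|u\|_{\rho-\beta}$ for all $u\in X^{\rho-\beta}$ and all $\rho\in[\lceil\beta-s_0-1\rceil,\beta-s_0)$; 5. $\|\mathcal C_1^{-1/2}u\|_{-s}\le c_2\|u\|_{\beta-s}$ for all $u\in X^{\beta-s}$ and all $s\in(s_0,1]$; 6. $\|\mathcal C_1^{-1/2}\mathcal A^{-1}u\|_{s}\le c_3\|u\|_{s+\beta-2\ell}$ for all $u\in X^{s+\beta-2\ell}$ and all $s\in(s_0,1]$; 7. $\|\mathcal A^{-1}\mathcal C_1^{-1}u\|_{-\eta}\le c_4\|u\|_{2\beta-2\ell-\eta}$ for all $u\in X^{2\beta-2\ell-\eta}$ and all $\eta\in[\beta-2\ell,1]$. Here an operator applied to an element outside its natural domain in $\mathcal X$ means its extension by continuity between the spaces of the scale in question; in 3, 4 and 6 the elements of $\mathcal X\cap X^t$ ($X^t$ the space named there) belong to the natural domain, and in 5 and 7 the natural domain (intersected with $X^t$) is dense in $X^t$. **Data and posterior mean.** Let $\xi\sim\mathcal N(0,\mathcal C_1)$ be a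 (generalized) Gaussian random element, i.e. its coordinates $\langle\xi,\phi_k\rangle$ are random variables such that $\langle \xi,h\rangle\sim N(0,\langle\mathcal C_1h,h\rangle)$ for every finite linear combination $h$ of the $\phi_k$. Let $u^\dagger\in X^1$ and, for $n>0$, $y^\dagger=\mathcal A^{-1}u^\dagger+n^{-1/2}\xi$. For $\lambda>0$ let $m^\dagger_\lambda\in X^1$ be the weak solution of $(\mathcal A^{-1}\mathcal C_1^{-1}\mathcal A^{-1}+\lambda\mathcal C_0^{-1})m^\dagger_\lambda=\mathcal A^{-1}\mathcal C_1^{-1}y^\dagger$, i.e. $$\langle\mathcal C_1^{-1/2}\mathcal A^{-1}m^\dagger_\lambda,\mathcal C_1^{-1/2}\mathcal A^{-1}v\rangle+\lambda\langle\mathcal C_0^{-1/2}m^\dagger_\lambda,\mathcal C_0^{-1/2}v\rangle=\langle\mathcal A^{-1}\mathcal C_1^{-1}y^\dagger,v\rangle\qquad\text{for all }v\in X^1,$$ where $\mathcal A^{-1}\mathcal C_1^{-1}y^\dagger\in X^{-1}$ and the right-hand side is the duality pairing of $X^{-1}$ and $X^1$. **Theorem.** For $\theta\in[0,1]$ put $\eta(\theta)=(1-\theta)(\beta-2\ell)+\theta$.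 Let $\theta_1,\theta_2\in[0,1]$ be such that $\mathbb E(\kappa^2)<\infty$, where $$\kappa=\max\{\|\xi\|_{2\beta-2\ell-\eta(\theta_1)},\ \|u^\dagger\|_{2-\eta(\theta_2)}\},$$ and let $$\tau(n)=n^{\frac{\theta_2-\theta_1-1}{2(\theta_1-\theta_2+2)}},\qquad \lambda=\lambda(n)=\frac1{n\,\tau(n)^2}.$$ Then for every $n>0$ the weak solution $m^\dagger_\lambda$ exists and is unique almost surely and is a random element of $\mathcal X$ (measurable up to null sets), and there is a constant $c>0$, independent of $n$ and $\theta$, such that for all $n>0$ and all $\theta\in[0,1]$ $$\mathbb E\,\|m^\dagger_\lambda-u^\dagger\|_{\eta(\theta)}^2\le c\,n^{\frac{\theta+\theta_2-2}{\theta_1-\theta_2+2}}.$$ -/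

import Mathlib

open MeasureTheory ProbabilityTheory Filter Topology
open scoped NNReal ENNReal InnerProductSpace

noncomputable section

namespace BayesInv

/-- The operators of the linear inverse problem `y = A⁻¹ u + n^{-1/2} ξ` on a separable
infinite-dimensional real Hilbert space `H`: the prior covariance `C₀`, the noise covariance `C₁`,
and the (generally unbounded) forward operator `A` with bounded inverse. -/
structure Model (H : Type*) [NormedAddCommGroup H] [InnerProductSpace ℝ H] [CompleteSpace H] where
  /-- the prior covariance, self-adjoint, positive definite -/
  C₀ : H →L[ℝ] H
  C₀_selfAdjoint : IsSelfAdjoint C₀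
  C₀_pos : ∀ x, x ≠ 0 → 0 < ⟪C₀ x, x⟫_ℝ
  /-- an orthonormal eigenbasis of `C₀` (countably infinite) with its eigenvalues -/
  φ : HilbertBasis ℕ ℝ H
  σ : ℕ → ℝ
  eigen : ∀ k, C₀ (φ k) = σ k • φ k
  /-- `C₀` is trace class -/
  C₀_trace : Summable σ
  /-- the noise covariance, bounded, self-adjoint, positive definite -/
  C₁ : H →L[ℝ] H
  C₁_selfAdjoint : IsSelfAdjoint C₁
  C₁_pos : ∀ x, x ≠ 0 → 0 < ⟪C₁ x, x⟫_ℝ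
  /-- `R = C₁^{1/2}`, the (unique) positive square root of `C₁` -/
  R : H →L[ℝ] H
  R_pos : R.IsPositive
  R_sq : R ∘L R = C₁
  /-- the forward operator: self-adjoint (hence densely defined), positive definite -/
  A : H →ₗ.[ℝ] H
  A_selfAdjoint : IsSelfAdjoint A
  A_pos : ∀ x : A.domain, (x : H) ≠ 0 → 0 < ⟪A x, (x : H)⟫_ℝ
  /-- its bounded inverse `A⁻¹` -/
  Ainv : H →L[ℝ] H
  A_Ainv : ∀ x, ∃ h : Ainv x ∈ A.domain, A ⟨Ainv x, h⟩ = x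
  Ainv_A : ∀ x : A.domain, Ainv (A x) = x

variable {H : Type*} [NormedAddCommGroup H] [InnerProductSpace ℝ H] [CompleteSpace H]

namespace Model

/-! ### The Hilbert scale

Elements of all the spaces `X^t`, `t ∈ ℝ`, are represented by their coefficient sequences in the
eigenbasis `φ`: the completion of `⋂ D(C₀^{-l})` in the norm `‖C₀^{-t/2} ·‖` is the space of all
sequences for which that norm is finite. -/

/-- The coefficients `⟨u, φ_k⟩` of `u ∈ H`. -/
def coeff (D : Model H) (u : H) : ℕ → ℝ := fun k => ⟪D.φ k, u⟫_ℝ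

/-- The power `C₀^t`, acting on coefficient sequences. -/
def pow (D : Model H) (t : ℝ) (a : ℕ → ℝ) : ℕ → ℝ := fun k => D.σ k ^ t * a k

/-- The norm `‖a‖_t = ‖C₀^{-t/2} a‖`, with value `∞` if `a ∉ X^t`. -/
def scaleNorm (D : Model H) (t : ℝ) (a : ℕ → ℝ) : ℝ≥0∞ :=
  (∑' k, ‖D.pow (-t / 2) a k‖ₑ ^ 2) ^ (1 / 2 : ℝ)

/-- `a ∈ X^t`. -/
def MemX (D : Model H) (t : ℝ) (a : ℕ → ℝ) : Prop := D.scaleNorm t a < ∞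

end Model

/-- The pairing `∑ a_k b_k`: the duality between `X^{-t}` and `X^t`, extending the inner product
of `H`. The series converges absolutely for `a ∈ X^{-t}`, `b ∈ X^t`. -/
def pairing (a b : ℕ → ℝ) : ℝ := ∑' k, a k * b k

namespace Model

/-! ### Operators between spaces of the scale

A partially defined operator `T` in `H` is given by its graph: `G u w` means that `u` belongs to
the domain of `T` and `T u = w`. -/

/-- The graph of `C₁^{-1/2}`. -/
def graphInvSqrt (D : Model H) (u w : H) : Prop := D.R w = u

/-- The graph of `C₁^{-1/2} A⁻¹`. -/
def graphInvSqrtAinv (D : Model H) (u w : H) : Prop := D.R w = D.Ainv u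

/-- The graph of `A⁻¹ C₁⁻¹`. -/
def graphAinvInv (D : Model H) (u w : H) : Prop := ∃ z, D.C₁ z = u ∧ D.Ainv z = w

/-- The operator with graph `G` is defined on `H ∩ X^p` and maps it to `X^q`, with
`‖T u‖_q ≤ c ‖u‖_p`. -/
def MapsBoundedly (D : Model H) (G : H → H → Prop) (p q : ℝ) (c : ℝ≥0) : Prop :=
  ∀ u, D.MemX p (D.coeff u) →
    ∃ w, G u w ∧ D.scaleNorm q (D.coeff w) ≤ c * D.scaleNorm p (D.coeff u)

/-- The operator `T` with graph `G` extends by continuity to a bounded operator `X^p → X^q` of norm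
at most `c`: it is densely defined in `X^p`, and `‖T u‖_q ≤ c ‖u‖_p` on its domain. -/
def ExtendsBoundedly (D : Model H) (G : H → H → Prop) (p q : ℝ) (c : ℝ≥0) : Prop :=
  (∀ a, D.MemX p a → ∀ ε : ℝ≥0∞, 0 < ε → ∃ u w, G u w ∧ D.scaleNorm p (a - D.coeff u) < ε) ∧
  ∀ u w, G u w → D.MemX p (D.coeff u) →
    D.scaleNorm q (D.coeff w) ≤ c * D.scaleNorm p (D.coeff u)

/-- `r ∈ X^q` is the value at `a ∈ X^p` of the extension by continuity of the operator with
graph `G`. -/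
def IsExtValue (D : Model H) (G : H → H → Prop) (p q : ℝ) (a r : ℕ → ℝ) : Prop :=
  D.MemX p a ∧ D.MemX q r ∧ ∃ u w : ℕ → H, (∀ j, G (u j) (w j)) ∧
    Tendsto (fun j => D.scaleNorm p (a - D.coeff (u j))) atTop (𝓝 0) ∧
    Tendsto (fun j => D.scaleNorm q (r - D.coeff (w j))) atTop (𝓝 0)

/-- The standing assumptions, expressing `C₁ ≃ C₀^β` and `A⁻¹ ≃ C₀^ℓ`. -/
structure Assumptions (D : Model H) (s₀ β ℓ : ℝ) : Prop where
  s₀_nonneg : 0 ≤ s₀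
  s₀_lt_one : s₀ < 1
  β_nonneg : 0 ≤ β
  ℓ_nonneg : 0 ≤ ℓ
  /-- `C₀^s` is trace class for all `s > s₀` -/
  trace : ∀ s, s₀ < s → Summable fun k => D.σ k ^ s
  /-- `Δ > 2 s₀`, where `Δ = 2ℓ - β + 1` -/
  delta : 2 * s₀ < 2 * ℓ - β + 1
  /-- `‖C₁^{-1/2} A⁻¹ u‖ ≍ ‖C₀^{ℓ-β/2} u‖` on `X^{β-2ℓ}` -/
  equiv : ∃ c c' : ℝ≥0, 0 < c ∧ 0 < c' ∧ ∀ u, D.MemX (β - 2 * ℓ) (D.coeff u) →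
    ∃ w, D.graphInvSqrtAinv u w ∧ c * D.scaleNorm (β - 2 * ℓ) (D.coeff u) ≤ ‖w‖ₑ ∧
      ‖w‖ₑ ≤ c' * D.scaleNorm (β - 2 * ℓ) (D.coeff u)
  /-- `‖C₀^{-ρ/2} C₁^{1/2} u‖ ≤ c₁ ‖C₀^{(β-ρ)/2} u‖` on `X^{ρ-β}` -/
  sqrt_bound : ∃ c₁ : ℝ≥0, 0 < c₁ ∧ ∀ ρ : ℝ, (⌈β - s₀ - 1⌉ : ℝ) ≤ ρ → ρ < β - s₀ →
    D.MapsBoundedly (fun u w => D.R u = w) (ρ - β) ρ c₁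
  /-- `‖C₀^{s/2} C₁^{-1/2} u‖ ≤ c₂ ‖C₀^{(s-β)/2} u‖` on `X^{β-s}` -/
  invSqrt_bound : ∃ c₂ : ℝ≥0, 0 < c₂ ∧ ∀ s, s₀ < s → s ≤ 1 →
    D.ExtendsBoundedly D.graphInvSqrt (β - s) (-s) c₂
  /-- `‖C₀^{-s/2} C₁^{-1/2} A⁻¹ u‖ ≤ c₃ ‖C₀^{(2ℓ-β-s)/2} u‖` on `X^{s+β-2ℓ}` -/
  invSqrtAinv_bound : ∃ c₃ : ℝ≥0, 0 < c₃ ∧ ∀ s, s₀ < s → s ≤ 1 →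
    D.MapsBoundedly D.graphInvSqrtAinv (s + β - 2 * ℓ) s c₃
  /-- `‖C₀^{η/2} A⁻¹ C₁⁻¹ u‖ ≤ c₄ ‖C₀^{η/2+ℓ-β} u‖` on `X^{2β-2ℓ-η}` -/
  ainvInv_bound : ∃ c₄ : ℝ≥0, 0 < c₄ ∧ ∀ η, β - 2 * ℓ ≤ η → η ≤ 1 →
    D.ExtendsBoundedly D.graphAinvInv (2 * β - 2 * ℓ - η) (-η) c₄

/-! ### Noise, data and posterior mean -/

/-- `ξ ∼ N(0, C₁)` as a (generalized) random element with coordinates `ξ_k = ⟨ξ, φ_k⟩`: every finite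
combination `⟨ξ, h⟩`, `h = ∑ c_k φ_k`, is a centred Gaussian of variance `⟨C₁ h, h⟩`. -/
structure IsNoise (D : Model H) {Ω : Type*} [MeasurableSpace Ω] (P : Measure Ω)
    (ξ : Ω → ℕ → ℝ) : Prop where
  measurable : Measurable ξ
  gaussian : ∀ c : ℕ →₀ ℝ, P.map (fun ω => c.sum fun k x => x * ξ ω k) =
    gaussianReal 0
      (⟪D.C₁ (c.sum fun k x => x • D.φ k), c.sum fun k x => x • D.φ k⟫_ℝ).toNNReal

/-- The data `y† = A⁻¹ u† + n^{-1/2} ξ`. -/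
def data (D : Model H) (u : H) (n : ℝ) (ξ : ℕ → ℝ) : ℕ → ℝ :=
  D.coeff (D.Ainv u) + (√n)⁻¹ • ξ

/-- `C₁^{-1/2} A⁻¹ u`, for `u` with `A⁻¹ u` in the range of the injective operator `C₁^{1/2}`. -/
def invSqrtAinv (D : Model H) (u : H) : H := Function.invFun D.R (D.Ainv u)

/-- `B(u,v) = ⟨C₁^{-1/2} A⁻¹ u, C₁^{-1/2} A⁻¹ v⟩ + lam ⟨C₀^{-1/2} u, C₀^{-1/2} v⟩` on `X^1`. -/
def bilin (D : Model H) (lam : ℝ) (u v : H) : ℝ :=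
  ⟪D.invSqrtAinv u, D.invSqrtAinv v⟫_ℝ +
    lam * pairing (D.pow (-1 / 2) (D.coeff u)) (D.pow (-1 / 2) (D.coeff v))

/-- `m ∈ X^1` is a weak solution of `B_lam m = A⁻¹ C₁⁻¹ y`, where `B_lam = A⁻¹ C₁⁻¹ A⁻¹ + lam C₀⁻¹`
and `A⁻¹ C₁⁻¹` is the extension `X^{2β-2ℓ-1} → X^{-1}`. -/
def IsPosteriorMean (D : Model H) (β ℓ lam : ℝ) (y : ℕ → ℝ) (m : H) : Prop :=
  D.MemX 1 (D.coeff m) ∧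
  ∃ r, D.IsExtValue D.graphAinvInv (2 * β - 2 * ℓ - 1) (-1) y r ∧
    ∀ v, D.MemX 1 (D.coeff v) → D.bilin lam m v = pairing r (D.coeff v)

end Model

/-- `η(θ) = (1-θ)(β-2ℓ) + θ`. -/
def eta (β ℓ θ : ℝ) : ℝ := (1 - θ) * (β - 2 * ℓ) + θ

/-- The scaling `τ(n)` of the prior. -/
def tau (θ₁ θ₂ n : ℝ) : ℝ := n ^ ((θ₂ - θ₁ - 1) / (2 * (θ₁ - θ₂ + 2)))

end BayesInv

end

noncomputable section

namespace BayesInv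

variable {H : Type*} [NormedAddCommGroup H] [InnerProductSpace ℝ H] [CompleteSpace H]

namespace Model

variable (D : Model H)

/-! ### The isometries `C₀^{t/2} : H → X^t` -/

/-! The argument is an energy estimate for the error `e = m - u`, for each realization of the noise.
Writing elements of `X^1` as `C₀^{1/2} x` and putting `K = C₁^{-1/2} A⁻¹ C₀^{1/2}`, the weak
equation becomes `K* K x + lam x = g` on `H`. It is coercive, so its solution depends continuously
on the data (`exists_solution_operator`).

The form `⟨C₁^{-1/2} A⁻¹ u, C₁^{-1/2} A⁻¹ v⟩` is the extended `A⁻¹ C₁⁻¹` at `A⁻¹ u`, paired with `v`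
(`exists_isExtValue_Ainv`). Hence the part of the data coming from `u` cancels, and testing the
error equation with `e` gives `‖C₁^{-1/2} A⁻¹ e‖² + lam ‖e‖_1² = n^{-1/2} ⟨A⁻¹ C₁⁻¹ ξ, e⟩ - lam
⟨C₀⁻¹ u, e⟩`. The left side dominates a multiple of `N = ‖e‖²_{β-2ℓ} + lam ‖e‖_1²`; the right side
is at most a multiple of `κ (n^{-1/2} ‖e‖_{η(θ₁)} + lam ‖e‖_{η(θ₂)})`. By `interpolation`,
`‖e‖²_{η(θ)} ≤ lam^{-θ} N` for every `θ`. Used for `θ₁` and `θ₂` this bounds `N` by a multiple of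
`κ² (n⁻¹ lam^{-θ₁} + lam^{2-θ₂})` (`le_of_energy`); used for `θ` it gives `error_bound`. The
prescribed `lam` balances the two terms, and integrating `κ²` yields the rate. -/

lemma sigma_pos (k : ℕ) : 0 < D.σ k := by
  have h := D.C₀_pos (D.φ k) (D.φ.orthonormal.ne_zero k)
  rwa [D.eigen, real_inner_smul_left, real_inner_self_eq_norm_sq, D.φ.orthonormal.1 k, one_pow,
    mul_one] at h

lemma repr_apply (u : H) (k : ℕ) : D.φ.repr u k = D.coeff u k := D.φ.repr_apply_apply u k

lemma coeff_injective : Function.Injective D.coeff := fun u v h =>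
  D.φ.repr.injective (lp.ext (funext fun k => by rw [D.repr_apply, D.repr_apply, h]))

lemma hasSum_coeff_mul (u v : H) : HasSum (fun k => D.coeff u k * D.coeff v k) ⟪u, v⟫_ℝ := by
  simpa only [coeff, real_inner_comm u] using D.φ.hasSum_inner_mul_inner u v

lemma hasSum_coeff_sq (u : H) : HasSum (fun k => D.coeff u k ^ 2) (‖u‖ ^ 2) := by
  simpa only [sq, real_inner_self_eq_norm_mul_norm] using D.hasSum_coeff_mul u u

lemma pow_pow (s t : ℝ) (a : ℕ → ℝ) : D.pow s (D.pow t a) = D.pow (s + t) a := by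
  funext k
  simp only [pow, Real.rpow_add (D.sigma_pos k), mul_assoc]

lemma pow_zero (a : ℕ → ℝ) : D.pow 0 a = a := by
  funext k
  simp [pow]

/-- The element `C₀^{t/2} h` of `X^t`, for `h ∈ H`. -/
def elt (t : ℝ) : H →ₗ[ℝ] (ℕ → ℝ) where
  toFun h := D.pow (t / 2) (D.coeff h)
  map_add' g h := by
    funext k
    simp [pow, coeff, inner_add_right, mul_add]
  map_smul' c h := by
    funext k
    simp [pow, coeff, inner_smul_right, mul_left_comm]

lemma elt_def (t : ℝ) (h : H) : D.elt t h = D.pow (t / 2) (D.coeff h) := rfl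

lemma coeff_eq_elt (h : H) : D.coeff h = D.elt 0 h := by
  rw [elt_def, zero_div, pow_zero]

lemma coeff_sub (u v : H) : D.coeff (u - v) = D.coeff u - D.coeff v := by
  simp only [coeff_eq_elt, map_sub]

lemma pow_elt (s t : ℝ) (h : H) : D.pow s (D.elt t h) = D.elt (2 * s + t) h := by
  rw [elt_def, elt_def, pow_pow]
  congr 1
  ring

lemma elt_injective (t : ℝ) : Function.Injective (D.elt t) := fun g h e => by
  have e' := congrArg (D.pow (-t / 2)) e
  rw [pow_elt, pow_elt] at e'
  apply D.coeff_injective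
  rw [coeff_eq_elt, coeff_eq_elt]
  convert e' using 2 <;> ring_nf

lemma scaleNorm_sq (t : ℝ) (a : ℕ → ℝ) :
    D.scaleNorm t a ^ 2 = ∑' k, ‖D.pow (-t / 2) a k‖ₑ ^ 2 := by
  rw [scaleNorm, ← ENNReal.rpow_natCast, ← ENNReal.rpow_mul]
  norm_num

lemma enorm_sq_eq_ofReal (x : ℝ) : ‖x‖ₑ ^ 2 = ENNReal.ofReal (x ^ 2) := by
  rw [← ofReal_norm, ← ENNReal.ofReal_pow (norm_nonneg x), Real.norm_eq_abs, sq_abs]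

lemma scaleNorm_elt (t : ℝ) (h : H) : D.scaleNorm t (D.elt t h) = ‖h‖ₑ := by
  have key : ∑' k, ‖D.pow (-t / 2) (D.elt t h) k‖ₑ ^ 2 = ‖h‖ₑ ^ 2 := by
    have e : D.pow (-t / 2) (D.elt t h) = D.coeff h := by
      rw [pow_elt, coeff_eq_elt]
      congr 2
      ring
    have hs := D.hasSum_coeff_sq h
    simp only [e, enorm_sq_eq_ofReal]
    rw [← ENNReal.ofReal_tsum_of_nonneg (fun k => sq_nonneg _) hs.summable, hs.tsum_eq,
      ENNReal.ofReal_pow (norm_nonneg h), ofReal_norm]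
  rw [scaleNorm, key, ← ENNReal.rpow_natCast, ← ENNReal.rpow_mul]
  norm_num

lemma memX_elt (t : ℝ) (h : H) : D.MemX t (D.elt t h) := by
  rw [MemX, scaleNorm_elt]
  exact enorm_lt_top

lemma MemX.exists_elt {D : Model H} {t : ℝ} {a : ℕ → ℝ} (ha : D.MemX t a) :
    ∃ h, D.elt t h = a := by
  have hs : Summable fun k => D.pow (-t / 2) a k ^ 2 := by
    have h2 : ∑' k, ENNReal.ofReal (D.pow (-t / 2) a k ^ 2) ≠ ∞ := by
      simp only [← enorm_sq_eq_ofReal]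
      rw [← scaleNorm_sq]
      exact ENNReal.pow_ne_top ha.ne
    simpa only [ENNReal.toReal_ofReal (sq_nonneg _)] using ENNReal.summable_toReal h2
  have hmem : Memℓp (D.pow (-t / 2) a) 2 := by
    refine memℓp_gen ?_
    simpa using hs
  refine ⟨D.φ.repr.symm ⟨_, hmem⟩, ?_⟩
  have e : D.coeff (D.φ.repr.symm ⟨_, hmem⟩) = D.pow (-t / 2) a := by
    funext k
    rw [← repr_apply, LinearIsometryEquiv.apply_symm_apply]
  rw [elt_def, e, pow_pow]
  convert D.pow_zero a using 2
  ring

lemma pairing_elt (t : ℝ) (g h : H) : pairing (D.elt (-t) g) (D.elt t h) = ⟪g, h⟫_ℝ := by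
  rw [pairing, ← (D.hasSum_coeff_mul g h).tsum_eq]
  refine tsum_congr fun k => ?_
  have e : D.σ k ^ (-t / 2) * D.σ k ^ (t / 2) = 1 := by
    rw [← Real.rpow_add (D.sigma_pos k)]
    ring_nf
    exact Real.rpow_zero _
  simp only [elt_def, pow]
  linear_combination (D.coeff g k * D.coeff h k) * e

lemma exists_sigma_le : ∃ M : ℝ, 0 < M ∧ ∀ k, D.σ k ≤ M := by
  obtain ⟨M, hM⟩ := D.C₀_trace.tendsto_atTop_zero.bddAbove_range
  have h : ∀ k, D.σ k ≤ M := fun k => hM ⟨k, rfl⟩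
  exact ⟨M, (D.sigma_pos 0).trans_le (h 0), h⟩

/-! ### The bounded powers of `C₀` -/

lemma exists_diag {t : ℝ} (ht : 0 ≤ t) :
    ∃ S : H →L[ℝ] H, ∀ h, D.coeff (S h) = D.pow t (D.coeff h) := by
  obtain ⟨M, hM, hσ⟩ := D.exists_sigma_le
  have hle (h : H) (k : ℕ) : D.pow t (D.coeff h) k ^ 2 ≤ (M ^ t) ^ 2 * D.coeff h k ^ 2 := by
    rw [pow, mul_pow]
    have h0 := Real.rpow_nonneg (D.sigma_pos k).le t
    have h1 := Real.rpow_le_rpow (D.sigma_pos k).le (hσ k) ht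
    gcongr
  have hsum (h : H) : Summable fun k => D.pow t (D.coeff h) k ^ 2 :=
    .of_nonneg_of_le (fun k => sq_nonneg _) (hle h) ((D.hasSum_coeff_sq h).summable.mul_left _)
  have hmem (h : H) : Memℓp (D.pow t (D.coeff h)) 2 := memℓp_gen (by simpa using hsum h)
  have hex (h : H) : ∃ g, D.coeff g = D.pow t (D.coeff h) :=
    ⟨D.φ.repr.symm ⟨_, hmem h⟩, funext fun k => by
      rw [← repr_apply, LinearIsometryEquiv.apply_symm_apply]⟩
  choose f hf using hex
  have hf' (h : H) : D.coeff (f h) = D.elt (2 * t) h := by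
    rw [hf, elt_def]
    congr 1
    ring
  let S : H →ₗ[ℝ] H :=
    { toFun := f
      map_add' := fun g h => D.coeff_injective <| by
        rw [hf', map_add, ← hf', ← hf', coeff_eq_elt, coeff_eq_elt, coeff_eq_elt, map_add]
      map_smul' := fun c h => D.coeff_injective <| by
        rw [hf', map_smul, ← hf', coeff_eq_elt, coeff_eq_elt, map_smul, RingHom.id_apply] }
  refine ⟨S.mkContinuous (M ^ t) fun h => ?_, hf⟩
  refine (sq_le_sq₀ (norm_nonneg _) (by positivity)).1 ?_
  rw [mul_pow, ← (D.hasSum_coeff_sq (S h)).tsum_eq, ← (D.hasSum_coeff_sq h).tsum_eq,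
    ← tsum_mul_left]
  refine Summable.tsum_le_tsum (fun k => ?_) (D.hasSum_coeff_sq (S h)).summable
    ((D.hasSum_coeff_sq h).summable.mul_left _)
  rw [show D.coeff (S h) = D.pow t (D.coeff h) from hf h]
  exact hle h k

/-- The bounded operator `C₀^t` on `H`, for `t ≥ 0` (and `0` for `t < 0`). -/
def diag (t : ℝ) : H →L[ℝ] H :=
  if ht : 0 ≤ t then (D.exists_diag ht).choose else 0

lemma coeff_diag {t : ℝ} (ht : 0 ≤ t) (h : H) : D.coeff (D.diag t h) = D.pow t (D.coeff h) := by
  rw [diag, dif_pos ht]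
  exact (D.exists_diag ht).choose_spec h

lemma elt_diag (t : ℝ) {r : ℝ} (hr : 0 ≤ r) (h : H) :
    D.elt t (D.diag r h) = D.elt (t + 2 * r) h := by
  rw [elt_def, coeff_diag D hr, pow_pow, elt_def]
  congr 1
  ring

/-- In the coordinates `elt`, the embedding of `X^t` into `X^s` is the bounded operator
`C₀^{(t-s)/2}`; every comparison of norms below goes through this. -/
lemma elt_eq_elt_diag {s t : ℝ} (hst : s ≤ t) (h : H) :
    D.elt t h = D.elt s (D.diag ((t - s) / 2) h) := by
  rw [elt_diag D s (by linarith)]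
  congr 2
  ring

lemma inner_diag (t : ℝ) (g h : H) : ⟪D.diag t g, h⟫_ℝ = ⟪g, D.diag t h⟫_ℝ := by
  by_cases ht : 0 ≤ t
  · rw [← (D.hasSum_coeff_mul _ _).tsum_eq, ← (D.hasSum_coeff_mul g _).tsum_eq]
    refine tsum_congr fun k => ?_
    rw [coeff_diag D ht, coeff_diag D ht, pow, pow]
    ring
  · simp [diag, dif_neg ht]

lemma MemX.mono {D : Model H} {s t : ℝ} (hst : s ≤ t) {a : ℕ → ℝ} (ha : D.MemX t a) :
    D.MemX s a := by
  obtain ⟨h, rfl⟩ := ha.exists_elt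
  rw [elt_eq_elt_diag D hst]
  exact D.memX_elt _ _

lemma memX_zero_coeff (h : H) : D.MemX 0 (D.coeff h) := by
  rw [coeff_eq_elt]
  exact D.memX_elt _ _

lemma MemX.sub {D : Model H} {t : ℝ} {a b : ℕ → ℝ} (ha : D.MemX t a) (hb : D.MemX t b) :
    D.MemX t (a - b) := by
  obtain ⟨g, rfl⟩ := ha.exists_elt
  obtain ⟨h, rfl⟩ := hb.exists_elt
  rw [← map_sub]
  exact D.memX_elt _ _

lemma scaleNorm_mono_bound {s t : ℝ} (hst : s ≤ t) {a : ℕ → ℝ} (ha : D.MemX t a) :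
    D.scaleNorm s a ≤ ‖D.diag ((t - s) / 2)‖ₑ * D.scaleNorm t a := by
  obtain ⟨h, rfl⟩ := ha.exists_elt
  rw [scaleNorm_elt, elt_eq_elt_diag D hst, scaleNorm_elt]
  exact ContinuousLinearMap.le_opENorm _ _

/-- The interpolation inequality
`μ^θ ‖x‖²_{η(θ)} ≤ ‖x‖²_p + μ ‖x‖²_1` with `η(θ) = (1-θ)p + θ`, for `C₀^{1/2} x`. -/
lemma interpolation {p θ μ : ℝ} (hp : p ≤ 1) (hθ : θ ∈ Set.Icc (0 : ℝ) 1) (hμ : 0 ≤ μ) (x : H) :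
    μ ^ θ * ‖D.diag ((1 - ((1 - θ) * p + θ)) / 2) x‖ ^ 2 ≤
      ‖D.diag ((1 - p) / 2) x‖ ^ 2 + μ * ‖x‖ ^ 2 := by
  obtain ⟨h0, h1⟩ := hθ
  have hη : 0 ≤ (1 - ((1 - θ) * p + θ)) / 2 := by nlinarith
  have hp' : 0 ≤ (1 - p) / 2 := by linarith
  refine hasSum_le (fun k => ?_) ((D.hasSum_coeff_sq _).mul_left _)
    ((D.hasSum_coeff_sq _).add ((D.hasSum_coeff_sq x).mul_left μ))
  rw [coeff_diag D hη, coeff_diag D hp', pow, pow, mul_pow, mul_pow, ← mul_assoc,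
    ← add_mul]
  refine mul_le_mul_of_nonneg_right ?_ (sq_nonneg _)
  have hσ := D.sigma_pos k
  have e1 (r : ℝ) : (D.σ k ^ (r / 2)) ^ 2 = D.σ k ^ r := by
    rw [← Real.rpow_natCast, ← Real.rpow_mul hσ.le]
    congr 1
    push_cast
    ring
  rw [e1, e1]
  -- Young's inequality in each coordinate: `(σ^{1-p})^{1-θ} μ^θ ≤ (1-θ) σ^{1-p} + θ μ`, and the
  -- weights are at most 1.
  have hy := Real.geom_mean_le_arith_mean2_weighted (sub_nonneg.2 h1) h0
    (Real.rpow_nonneg hσ.le (1 - p)) hμ (sub_add_cancel 1 θ)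
  rw [← Real.rpow_mul hσ.le] at hy
  have e2 : 1 - ((1 - θ) * p + θ) = (1 - p) * (1 - θ) := by ring
  rw [e2, mul_comm]
  have h3 := Real.rpow_nonneg hσ.le (1 - p)
  nlinarith

/-! ### Extension by continuity -/

lemma tendsto_scaleNorm_elt_sub {t : ℝ} {h : H} {g : ℕ → H} :
    Tendsto (fun j => D.scaleNorm t (D.elt t h - D.elt t (g j))) atTop (𝓝 0) ↔
      Tendsto g atTop (𝓝 h) := by
  simp only [← map_sub, scaleNorm_elt]
  rw [tendsto_iff_edist_tendsto_0]
  simp only [edist_comm _ h, edist_eq_enorm_sub]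

/-- If the graph of an operator is a linear subspace, its extension by continuity `X^p → X^q` is a
bounded operator, here transported to `H` by the isometries `C₀^{p/2}` and `C₀^{q/2}`. -/
lemma ExtendsBoundedly.exists_clm {D : Model H} {G : H → H → Prop} {p q : ℝ} {c : ℝ≥0}
    (hG : D.ExtendsBoundedly G p q c) (Γ : Submodule ℝ (H × H)) (hΓ : ∀ u w, G u w ↔ (u, w) ∈ Γ) :
    ∃ T : H →L[ℝ] H, (∀ h, ‖T h‖ ≤ c * ‖h‖) ∧
      ∀ h r, D.IsExtValue G p q (D.elt p h) r ↔ D.elt q (T h) = r := by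
  -- The graph of the operator in the coordinates of `X^p` and `X^q`. Its first projection `e` has
  -- dense range and dominates the second projection `f`, so `f` factors through a bounded `T` with
  -- `T ∘ e = f`.
  let Z : Submodule ℝ (H × H) :=
    { carrier := {γ | ∃ u w, G u w ∧ D.coeff u = D.elt p γ.1 ∧ D.coeff w = D.elt q γ.2}
      add_mem' := by
        rintro γ γ' ⟨u, w, h, h1, h2⟩ ⟨u', w', h', h1', h2'⟩
        refine ⟨u + u', w + w', ?_, ?_, ?_⟩
        · rw [hΓ] at *
          exact Γ.add_mem h h'
        · rw [coeff_eq_elt] at *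
          rw [map_add, h1, h1', Prod.fst_add, map_add]
        · rw [coeff_eq_elt] at *
          rw [map_add, h2, h2', Prod.snd_add, map_add]
      zero_mem' := ⟨0, 0, by rw [hΓ]; exact Γ.zero_mem, by simp [coeff_eq_elt],
        by simp [coeff_eq_elt]⟩
      smul_mem' := by
        rintro a γ ⟨u, w, h, h1, h2⟩
        refine ⟨a • u, a • w, ?_, ?_, ?_⟩
        · rw [hΓ] at *
          exact Γ.smul_mem a h
        · rw [coeff_eq_elt] at *
          rw [map_smul, h1, Prod.smul_fst, map_smul]
        · rw [coeff_eq_elt] at *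
          rw [map_smul, h2, Prod.smul_snd, map_smul] }
  let e : Z →ₗ[ℝ] H := LinearMap.fst ℝ H H ∘ₗ Z.subtype
  let f : Z →ₗ[ℝ] H := LinearMap.snd ℝ H H ∘ₗ Z.subtype
  have hbound (u w : H) (h : G u w) (hu : D.MemX p (D.coeff u)) : D.MemX q (D.coeff w) :=
    (hG.2 u w h hu).trans_lt (ENNReal.mul_lt_top ENNReal.coe_lt_top hu)
  have hnorm (z : Z) : ‖f z‖ ≤ c * ‖e z‖ := by
    obtain ⟨γ, u, w, h, h1, h2⟩ := z
    have := hG.2 u w h (by rw [h1]; exact D.memX_elt _ _)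
    rw [h1, h2, scaleNorm_elt, scaleNorm_elt, ← ofReal_norm, ← ofReal_norm,
      ← ENNReal.ofReal_coe_nnreal, ← ENNReal.ofReal_mul c.coe_nonneg] at this
    exact (ENNReal.ofReal_le_ofReal_iff (by positivity)).1 this
  have hdense : DenseRange e := by
    intro h
    rw [EMetric.mem_closure_iff]
    intro ε hε
    obtain ⟨u, w, hg, hlt⟩ := hG.1 (D.elt p h) (D.memX_elt _ _) ε hε
    have hu : D.MemX p (D.coeff u) := by
      have h2 : D.MemX p (D.elt p h - D.coeff u) := lt_of_lt_of_le hlt le_top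
      simpa using (D.memX_elt p h).sub h2
    obtain ⟨g, hgu⟩ := hu.exists_elt
    obtain ⟨k, hkw⟩ := (hbound u w hg hu).exists_elt
    refine ⟨g, ⟨⟨(g, k), u, w, hg, hgu.symm, hkw.symm⟩, rfl⟩, ?_⟩
    rwa [← hgu, ← map_sub, scaleNorm_elt, ← edist_eq_enorm_sub] at hlt
  let T := f.extendOfNorm e
  have hT (z : Z) : T (e z) = f z := LinearMap.extendOfNorm_eq hdense ⟨c, hnorm⟩ z
  refine ⟨T, LinearMap.norm_extendOfNorm_apply_le hdense c hnorm, fun h r => ⟨?_, ?_⟩⟩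
  · rintro ⟨-, hr, u, w, hg, hu, hw⟩
    obtain ⟨k, rfl⟩ := hr.exists_elt
    -- Only eventually: finitely many `u j` may lie outside `X^p`.
    have hev : ∀ᶠ j in atTop, ∃ z : Z, D.coeff (u j) = D.elt p (e z) ∧
        D.coeff (w j) = D.elt q (f z) := by
      filter_upwards [hu.eventually_lt_const ENNReal.zero_lt_top] with j hj
      have hu : D.MemX p (D.coeff (u j)) := by simpa using (D.memX_elt p h).sub hj
      obtain ⟨g, hgu⟩ := hu.exists_elt
      obtain ⟨k, hkw⟩ := (hbound _ _ (hg j) hu).exists_elt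
      exact ⟨⟨(g, k), u j, w j, hg j, hgu.symm, hkw.symm⟩, hgu.symm, hkw.symm⟩
    obtain ⟨z, hz⟩ := hev.choice
    have h1 : Tendsto (fun j => e (z j)) atTop (𝓝 h) := by
      rw [← D.tendsto_scaleNorm_elt_sub (t := p)]
      refine hu.congr' ?_
      filter_upwards [hz] with j hj
      rw [hj.1]
    have h2 : Tendsto (fun j => f (z j)) atTop (𝓝 k) := by
      rw [← D.tendsto_scaleNorm_elt_sub (t := q)]
      refine hw.congr' ?_
      filter_upwards [hz] with j hj
      rw [hj.2]
    have h3 := (T.continuous.tendsto h).comp h1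
    simp only [Function.comp_def, hT] at h3
    rw [tendsto_nhds_unique h3 h2]
  · rintro rfl
    obtain ⟨g, hg, hlim⟩ := mem_closure_iff_seq_limit.1 (hdense h)
    choose z hz using hg
    choose u w hG' hu hw using fun j => (z j).2
    refine ⟨D.memX_elt _ _, D.memX_elt _ _, u, w, hG', ?_, ?_⟩
    · simp only [hu]
      rw [tendsto_scaleNorm_elt_sub]
      exact hlim.congr fun j => (hz j).symm
    · simp only [hw]
      rw [tendsto_scaleNorm_elt_sub]
      refine ((T.continuous.tendsto h).comp hlim).congr fun j => ?_
      rw [Function.comp_apply, ← hz j, hT]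
      rfl

lemma tendsto_scaleNorm_mono {s t : ℝ} (hst : s ≤ t) {a : ℕ → ℕ → ℝ}
    (h : Tendsto (fun j => D.scaleNorm t (a j)) atTop (𝓝 0)) :
    Tendsto (fun j => D.scaleNorm s (a j)) atTop (𝓝 0) := by
  have h1 : Tendsto (fun j => ‖D.diag ((t - s) / 2)‖ₑ * D.scaleNorm t (a j)) atTop (𝓝 0) := by
    simpa using ENNReal.Tendsto.const_mul h (.inr enorm_ne_top)
  refine tendsto_of_tendsto_of_tendsto_of_le_of_le' tendsto_const_nhds h1
    (.of_forall fun _ => zero_le) ?_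
  filter_upwards [h.eventually_lt_const ENNReal.zero_lt_top] with j hj
  exact D.scaleNorm_mono_bound hst hj

/-- The same approximating sequences converge in the weaker norms. This makes the extensions of `A⁻¹
C₁⁻¹` for different `η` compatible. -/
lemma IsExtValue.mono {D : Model H} {G : H → H → Prop} {p p' q q' : ℝ} {a r : ℕ → ℝ}
    (h : D.IsExtValue G p q a r) (hp : p' ≤ p) (hq : q' ≤ q) : D.IsExtValue G p' q' a r := by
  obtain ⟨ha, hr, u, w, hG, hu, hw⟩ := h
  exact ⟨ha.mono hp, hr.mono hq, u, w, hG, D.tendsto_scaleNorm_mono hp hu,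
    D.tendsto_scaleNorm_mono hq hw⟩

lemma tendsto_pairing {t : ℝ} {r b : ℕ → ℝ} (hr : D.MemX (-t) r) (hb : D.MemX t b)
    {a : ℕ → ℕ → ℝ} (h : Tendsto (fun j => D.scaleNorm (-t) (r - a j)) atTop (𝓝 0)) :
    Tendsto (fun j => pairing (a j) b) atTop (𝓝 (pairing r b)) := by
  obtain ⟨g, rfl⟩ := hr.exists_elt
  obtain ⟨x, rfl⟩ := hb.exists_elt
  have hev : ∀ᶠ j in atTop, ∃ k, D.elt (-t) k = a j := by
    filter_upwards [h.eventually_lt_const ENNReal.zero_lt_top] with j hj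
    have : D.MemX (-t) (a j) := by simpa using (D.memX_elt (-t) g).sub hj
    exact this.exists_elt
  obtain ⟨k, hk⟩ := hev.choice
  have hlim : Tendsto k atTop (𝓝 g) := by
    rw [← D.tendsto_scaleNorm_elt_sub (t := -t)]
    refine h.congr' ?_
    filter_upwards [hk] with j hj
    rw [hj]
  rw [pairing_elt]
  refine (hlim.inner tendsto_const_nhds).congr' ?_
  filter_upwards [hk] with j hj
  rw [← hj, pairing_elt]

/-! ### The operators of the inverse problem -/

lemma inner_R (x y : H) : ⟪D.R x, y⟫_ℝ = ⟪x, D.R y⟫_ℝ := D.R_pos.isSymmetric x y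

lemma R_R (x : H) : D.R (D.R x) = D.C₁ x := by
  rw [← D.R_sq]
  rfl

lemma R_injective : Function.Injective D.R := by
  rw [injective_iff_map_eq_zero]
  intro x hx
  by_contra h
  have := D.C₁_pos x h
  rw [← R_R, hx, map_zero, inner_zero_left] at this
  exact this.false

/-- Symmetry of `A`, applied to `A⁻¹ x` and `A⁻¹ y`. -/
lemma inner_Ainv (x y : H) : ⟪D.Ainv x, y⟫_ℝ = ⟪x, D.Ainv y⟫_ℝ := by
  obtain ⟨hx, ex⟩ := D.A_Ainv x
  obtain ⟨hy, ey⟩ := D.A_Ainv y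
  have h := LinearPMap.adjoint_isFormalAdjoint D.A_selfAdjoint.dense_domain
  rw [LinearPMap.isSelfAdjoint_def.1 D.A_selfAdjoint] at h
  have := h ⟨_, hx⟩ ⟨_, hy⟩
  rw [ex, ey] at this
  exact this.symm

lemma invSqrtAinv_eq {u w : H} (h : D.R w = D.Ainv u) : D.invSqrtAinv u = w := by
  rw [invSqrtAinv, ← h, Function.leftInverse_invFun D.R_injective]

/-- The graph of `A⁻¹ C₁⁻¹` as a subspace. -/
def graphAinvInvSubmodule : Submodule ℝ (H × H) := LinearMap.range (D.C₁.prod D.Ainv).toLinearMap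

lemma graphAinvInv_iff (u w : H) : D.graphAinvInv u w ↔ (u, w) ∈ D.graphAinvInvSubmodule := by
  simp [graphAinvInv, graphAinvInvSubmodule]

variable {D} {s₀ β ℓ : ℝ}

namespace Assumptions

lemma p_lt_one (hD : D.Assumptions s₀ β ℓ) : β - 2 * ℓ < 1 := by
  linarith [hD.delta, hD.s₀_nonneg]

lemma R_invSqrtAinv (hD : D.Assumptions s₀ β ℓ) {u : H} (hu : D.MemX 1 (D.coeff u)) :
    D.R (D.invSqrtAinv u) = D.Ainv u := by
  obtain ⟨c, c', -, -, h⟩ := hD.equiv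
  obtain ⟨w, hw, -⟩ := h u (hu.mono hD.p_lt_one.le)
  rw [D.invSqrtAinv_eq hw, hw]

/-- `A⁻¹` maps `X^1` to `X^ρ` for all `ρ < β - s₀`. -/
lemma memX_Ainv (hD : D.Assumptions s₀ β ℓ) {u : H} (hu : D.MemX 1 (D.coeff u)) {ρ : ℝ}
    (hρ : ρ < β - s₀) : D.MemX ρ (D.coeff (D.Ainv u)) := by
  obtain ⟨c, -, h⟩ := hD.sqrt_bound
  have hceil : (⌈β - s₀ - 1⌉ : ℝ) < β - s₀ := by linarith [Int.ceil_lt_add_one (β - s₀ - 1)]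
  have hm := hD.s₀_nonneg
  have hmax : max (⌈β - s₀ - 1⌉ : ℝ) ρ < β - s₀ := max_lt hceil hρ
  -- `A⁻¹ u = C₁^{1/2} w` with `w ∈ H`, and `H` embeds in `X^{ρ'-β}` since `ρ' < β`. Raising `ρ` to
  -- the maximum `ρ'` brings it into the range where `sqrt_bound` is assumed.
  have hW : D.MemX (max (⌈β - s₀ - 1⌉ : ℝ) ρ - β) (D.coeff (D.invSqrtAinv u)) :=
    (D.memX_zero_coeff _).mono (by linarith)
  obtain ⟨w, hw, hle⟩ := h _ (le_max_left _ ρ) hmax _ hW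
  have e : w = D.Ainv u := by rw [← hw, hD.R_invSqrtAinv hu]
  subst e
  exact MemX.mono (le_max_right _ _)
    (hle.trans_lt (ENNReal.mul_lt_top ENNReal.coe_lt_top hW))

/-- The extension of `A⁻¹ C₁⁻¹` at `A⁻¹ u` represents the form
`v ↦ ⟨C₁^{-1/2} A⁻¹ u, C₁^{-1/2} A⁻¹ v⟩` on `X^1`. -/
lemma exists_isExtValue_Ainv (hD : D.Assumptions s₀ β ℓ) {u : H} (hu : D.MemX 1 (D.coeff u)) :
    ∃ r, D.IsExtValue D.graphAinvInv (2 * β - 2 * ℓ - 1) (-1) (D.coeff (D.Ainv u)) r ∧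
      ∀ v, D.MemX 1 (D.coeff v) →
        pairing r (D.coeff v) = ⟪D.invSqrtAinv u, D.invSqrtAinv v⟫_ℝ := by
  -- With `η = β - 2ℓ + s`, the bound `s ≤ Δ` gives `η ≤ 1`, and the source space `X^{2β-2ℓ-η}` is
  -- `X^{β-s}`, which contains `A⁻¹ u` because `s > s₀`.
  obtain ⟨s, hs0, hs1, hsΔ⟩ : ∃ s, s₀ < s ∧ s ≤ 1 ∧ s ≤ 2 * ℓ - β + 1 :=
    ⟨min 1 (2 * ℓ - β + 1), lt_min hD.s₀_lt_one (by linarith [hD.delta, hD.s₀_nonneg]),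
      min_le_left _ _, min_le_right _ _⟩
  have hs : 0 < s := hD.s₀_nonneg.trans_lt hs0
  set η := β - 2 * ℓ + s with hη
  have hη1 : η ≤ 1 := by linarith
  obtain ⟨c₄, -, h₄⟩ := hD.ainvInv_bound
  obtain ⟨T, -, hT⟩ := (h₄ η (by linarith) hη1).exists_clm _ D.graphAinvInv_iff
  have hq : 2 * β - 2 * ℓ - η = β - s := by rw [hη]; ring
  have hmem : D.MemX (2 * β - 2 * ℓ - η) (D.coeff (D.Ainv u)) := by
    rw [hq]
    exact hD.memX_Ainv hu (by linarith)
  obtain ⟨h, hh⟩ := hmem.exists_elt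
  have hext := (hT h _).2 rfl
  rw [hh] at hext
  refine ⟨_, hext.mono (by linarith) (by linarith), fun v hv => ?_⟩
  obtain ⟨-, hr, x, w, hG, hx, hw⟩ := hext
  choose z hzx hzw using hG
  have hlim := D.tendsto_pairing hr (hv.mono hη1) hw
  obtain ⟨c₂, -, h₂⟩ := hD.invSqrt_bound
  obtain ⟨c₃, -, h₃⟩ := hD.invSqrtAinv_bound
  have hWv : D.MemX s (D.coeff (D.invSqrtAinv v)) := by
    have hv' : D.MemX (s + β - 2 * ℓ) (D.coeff v) := hv.mono (by linarith)
    obtain ⟨w, hw, hle⟩ := h₃ s hs0 hs1 v hv'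
    rw [D.invSqrtAinv_eq hw]
    exact hle.trans_lt (ENNReal.mul_lt_top ENNReal.coe_lt_top hv')
  -- Here `x j = C₁ (z j)`, so `C₁^{-1/2} (A⁻¹ u - x j) = C₁^{-1/2} A⁻¹ u - R (z j)`, and
  -- `invSqrt_bound` turns convergence in `X^{β-s}` into convergence in `X^{-s}`.
  have hRz : Tendsto (fun j => D.scaleNorm (-s) (D.coeff (D.invSqrtAinv u) - D.coeff (D.R (z j))))
      atTop (𝓝 0) := by
    rw [hq] at hx
    have h1 : Tendsto (fun j => c₂ * D.scaleNorm (β - s) (D.coeff (D.Ainv u) - D.coeff (x j)))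
        atTop (𝓝 0) := by
      simpa using ENNReal.Tendsto.const_mul hx (.inr ENNReal.coe_ne_top)
    refine tendsto_of_tendsto_of_tendsto_of_le_of_le' tendsto_const_nhds h1
      (.of_forall fun _ => zero_le) ?_
    filter_upwards [hx.eventually_lt_const ENNReal.zero_lt_top] with j hj
    rw [← coeff_sub] at hj ⊢
    rw [← coeff_sub]
    refine (h₂ s hs0 hs1).2 _ _ ?_ hj
    rw [graphInvSqrt, map_sub, hD.R_invSqrtAinv hu, R_R, hzx]
  have hlim' := D.tendsto_pairing ((D.memX_zero_coeff _).mono (by linarith)) hWv hRz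
  have hin (g k : H) : pairing (D.coeff g) (D.coeff k) = ⟪g, k⟫_ℝ :=
    (D.hasSum_coeff_mul g k).tsum_eq
  simp only [hin] at hlim hlim'
  -- Both limits are of one sequence: `⟨A⁻¹ z, v⟩ = ⟨z, A⁻¹ v⟩ = ⟨R z, C₁^{-1/2} A⁻¹ v⟩`.
  refine tendsto_nhds_unique hlim (hlim'.congr fun j => ?_)
  rw [inner_R, hD.R_invSqrtAinv hv, ← hzw, inner_Ainv]

end Assumptions

end Model

/-! ### Solvability of the regularized problem -/

/-- The bounded solution operator of the coercive problem
`⟨K x, K y⟩ + lam ⟨x, y⟩ = ⟨g, y⟩` for all `y`. -/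
lemma exists_regularized_inverse (K : H →L[ℝ] H) {lam : ℝ} (hlam : 0 < lam) :
    ∃ L : H →L[ℝ] H, ∀ g x,
      (∀ y, ⟪K x, K y⟫_ℝ + lam * ⟪x, y⟫_ℝ = ⟪g, y⟫_ℝ) ↔ x = L g := by
  let B : H →L[ℝ] H →L[ℝ] ℝ :=
    innerSL ℝ ∘L (ContinuousLinearMap.adjoint K ∘L K + lam • ContinuousLinearMap.id ℝ H)
  have hB (x y : H) : B x y = ⟪K x, K y⟫_ℝ + lam * ⟪x, y⟫_ℝ := by
    change ⟪ContinuousLinearMap.adjoint K (K x) + lam • x, y⟫_ℝ = _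
    rw [inner_add_left, real_inner_smul_left, ContinuousLinearMap.adjoint_inner_left]
  have hco : IsCoercive B := by
    refine ⟨lam, hlam, fun x => ?_⟩
    rw [hB, real_inner_self_eq_norm_mul_norm, real_inner_self_eq_norm_mul_norm]
    nlinarith [mul_self_nonneg ‖K x‖]
  let Λ := hco.continuousLinearEquivOfBilin
  refine ⟨Λ.symm, fun g x => ?_⟩
  rw [ContinuousLinearEquiv.coe_coe, ContinuousLinearEquiv.eq_symm_apply]
  constructor
  · intro h
    exact (hco.unique_continuousLinearEquivOfBilin fun y => by rw [hB, h]).symm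
  · rintro rfl y
    rw [hco.continuousLinearEquivOfBilin_apply, hB]

/-! ### The weak equation in the coordinates `m = C₀^{1/2} x` -/

namespace Model

variable {D : Model H} {s₀ β ℓ : ℝ}

lemma coeff_diag_half (x : H) : D.coeff (D.diag (1 / 2) x) = D.elt 1 x := by
  rw [coeff_eq_elt, elt_diag D 0 (by norm_num)]
  norm_num

lemma memX_one_diag_half (x : H) : D.MemX 1 (D.coeff (D.diag (1 / 2) x)) := by
  rw [coeff_diag_half]
  exact D.memX_elt _ _

lemma exists_diag_half_eq {u : H} (hu : D.MemX 1 (D.coeff u)) : ∃ x, D.diag (1 / 2) x = u := by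
  obtain ⟨x, hx⟩ := hu.exists_elt
  exact ⟨x, D.coeff_injective (by rw [coeff_diag_half, hx])⟩

lemma scaleNorm_coeff_diag_half {t : ℝ} (ht : t ≤ 1) (x : H) :
    D.scaleNorm t (D.coeff (D.diag (1 / 2) x)) = ‖D.diag ((1 - t) / 2) x‖ₑ := by
  rw [coeff_diag_half, elt_eq_elt_diag D ht, scaleNorm_elt]

namespace Assumptions

/-- The operator `K = C₁^{-1/2} A⁻¹ C₀^{1/2}` is bounded, and `‖K x‖` dominates
`‖C₀^{1/2} x‖_{β-2ℓ}`. -/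
lemma exists_whitened (hD : D.Assumptions s₀ β ℓ) :
    ∃ K : H →L[ℝ] H, (∀ x, D.invSqrtAinv (D.diag (1 / 2) x) = K x) ∧
      ∃ c : ℝ, 0 < c ∧ ∀ x, c * ‖D.diag ((1 - (β - 2 * ℓ)) / 2) x‖ ≤ ‖K x‖ := by
  obtain ⟨c, c', hc, -, h⟩ := hD.equiv
  have hR (x : H) : D.R (D.invSqrtAinv (D.diag (1 / 2) x)) = D.Ainv (D.diag (1 / 2) x) :=
    hD.R_invSqrtAinv (memX_one_diag_half x)
  have hb (x : H) : c * ‖D.diag ((1 - (β - 2 * ℓ)) / 2) x‖ ≤ ‖D.invSqrtAinv (D.diag (1 / 2) x)‖ ∧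
      ‖D.invSqrtAinv (D.diag (1 / 2) x)‖ ≤ c' * ‖D.diag ((1 - (β - 2 * ℓ)) / 2) x‖ := by
    obtain ⟨w, hw, h1, h2⟩ := h _ ((memX_one_diag_half x).mono hD.p_lt_one.le)
    rw [scaleNorm_coeff_diag_half hD.p_lt_one.le, enorm_eq_nnnorm, enorm_eq_nnnorm] at h1 h2
    rw [D.invSqrtAinv_eq hw]
    exact ⟨by exact_mod_cast h1, by exact_mod_cast h2⟩
  -- `invSqrtAinv` is a choice of preimage under `R`; its linearity on `X^1` comes from injectivity
  -- of `R`.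
  let K₀ : H →ₗ[ℝ] H :=
    { toFun := fun x => D.invSqrtAinv (D.diag (1 / 2) x)
      map_add' := fun x y => D.R_injective (by rw [hR, map_add, map_add, map_add, hR, hR])
      map_smul' := fun a x => D.R_injective (by
        rw [hR, RingHom.id_apply, map_smul, map_smul, map_smul, hR]) }
  refine ⟨K₀.mkContinuous (c' * ‖D.diag ((1 - (β - 2 * ℓ)) / 2)‖) fun x => ?_, fun x => rfl, c,
    by exact_mod_cast hc, fun x => (hb x).1⟩
  refine (hb x).2.trans ?_
  rw [mul_assoc]
  exact mul_le_mul_of_nonneg_left (ContinuousLinearMap.le_opNorm _ _) c'.coe_nonneg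

lemma bilin_diag_half {K : H →L[ℝ] H} (hK : ∀ x, D.invSqrtAinv (D.diag (1 / 2) x) = K x)
    (lam : ℝ) (x y : H) :
    D.bilin lam (D.diag (1 / 2) x) (D.diag (1 / 2) y) = ⟪K x, K y⟫_ℝ + lam * ⟪x, y⟫_ℝ := by
  have e (z : H) : D.pow (-1 / 2) (D.elt 1 z) = D.coeff z := by
    rw [pow_elt, coeff_eq_elt]
    norm_num
  rw [bilin, hK, hK, coeff_diag_half, coeff_diag_half, e, e, pairing,
    (D.hasSum_coeff_mul x y).tsum_eq]

/-- The extension of `A⁻¹ C₁⁻¹` to an operator `X^{2β-2ℓ-η} → X^{-η}`. -/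
lemma exists_ext (hD : D.Assumptions s₀ β ℓ) :
    ∃ c₄ : ℝ, 0 < c₄ ∧ ∀ η, β - 2 * ℓ ≤ η → η ≤ 1 →
      ∃ T : H →L[ℝ] H, (∀ h, ‖T h‖ ≤ c₄ * ‖h‖) ∧
        ∀ h r, D.IsExtValue D.graphAinvInv (2 * β - 2 * ℓ - η) (-η)
          (D.elt (2 * β - 2 * ℓ - η) h) r ↔ D.elt (-η) (T h) = r := by
  obtain ⟨c, hc, h⟩ := hD.ainvInv_bound
  exact ⟨c, by exact_mod_cast hc, fun η h1 h2 =>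
    (h η h1 h2).exists_clm _ D.graphAinvInv_iff⟩

/-- The substitution `m = C₀^{1/2} x`, `v = C₀^{1/2} y` is a bijection from `H` onto `X^1`, and
turns the duality of `X^{-1}` and `X^1` into the inner product of `H`. -/
lemma isPosteriorMean_iff {K T : H →L[ℝ] H}
    (hK : ∀ x, D.invSqrtAinv (D.diag (1 / 2) x) = K x)
    (hT : ∀ h r, D.IsExtValue D.graphAinvInv (2 * β - 2 * ℓ - 1) (-1)
      (D.elt (2 * β - 2 * ℓ - 1) h) r ↔ D.elt (-1) (T h) = r) (lam : ℝ) (h m : H) :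
    D.IsPosteriorMean β ℓ lam (D.elt (2 * β - 2 * ℓ - 1) h) m ↔
      ∃ x, D.diag (1 / 2) x = m ∧
        ∀ y, ⟪K x, K y⟫_ℝ + lam * ⟪x, y⟫_ℝ = ⟪T h, y⟫_ℝ := by
  constructor
  · rintro ⟨hm, r, hr, hw⟩
    obtain ⟨x, rfl⟩ := exists_diag_half_eq hm
    rw [hT] at hr
    subst hr
    refine ⟨x, rfl, fun y => ?_⟩
    rw [← bilin_diag_half hK, hw _ (memX_one_diag_half y), coeff_diag_half, pairing_elt]
  · rintro ⟨x, rfl, hx⟩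
    refine ⟨memX_one_diag_half x, _, (hT h _).2 rfl, fun v hv => ?_⟩
    obtain ⟨y, rfl⟩ := exists_diag_half_eq hv
    rw [bilin_diag_half hK, hx, coeff_diag_half, pairing_elt]

/-- The posterior mean exists, is unique, and depends linearly and continuously on the data in
`X^{2β-2ℓ-1}`. -/
lemma exists_solution_operator (hD : D.Assumptions s₀ β ℓ) {lam : ℝ} (hlam : 0 < lam) :
    ∃ M : H →L[ℝ] H, ∀ h m,
      D.IsPosteriorMean β ℓ lam (D.elt (2 * β - 2 * ℓ - 1) h) m ↔ m = M h := by
  obtain ⟨K, hK, -⟩ := hD.exists_whitened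
  obtain ⟨c₄, -, h₄⟩ := hD.exists_ext
  obtain ⟨T, -, hT⟩ := h₄ 1 hD.p_lt_one.le le_rfl
  obtain ⟨L, hL⟩ := exists_regularized_inverse K hlam
  refine ⟨D.diag (1 / 2) ∘L L ∘L T, fun h m => ?_⟩
  rw [isPosteriorMean_iff hK hT]
  simp only [hL, ContinuousLinearMap.comp_apply]
  constructor
  · rintro ⟨x, rfl, rfl⟩
    rfl
  · rintro rfl
    exact ⟨_, rfl, rfl⟩

end Assumptions

/-! ### The error estimate for one realization -/

lemma eta_mem {p θ : ℝ} (hp : p ≤ 1) (hθ : θ ∈ Set.Icc (0 : ℝ) 1) :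
    p ≤ (1 - θ) * p + θ ∧ (1 - θ) * p + θ ≤ 1 := by
  obtain ⟨h0, h1⟩ := hθ
  constructor <;> nlinarith

/-- An energy inequality `c N ≤ a α₁ + b α₂` with `α_i² ≤ μ_i N` bounds `N`. -/
lemma le_of_energy {c N a b α₁ α₂ μ₁ μ₂ : ℝ} (hc : 0 < c) (hN : 0 ≤ N)
    (h : c * N ≤ a * α₁ + b * α₂) (h₁ : α₁ ^ 2 ≤ μ₁ * N) (h₂ : α₂ ^ 2 ≤ μ₂ * N)
    (hμ₁ : 0 ≤ μ₁) (hμ₂ : 0 ≤ μ₂) :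
    N ≤ 2 / c ^ 2 * (a ^ 2 * μ₁ + b ^ 2 * μ₂) := by
  rcases hN.eq_or_lt with rfl | hN
  · positivity
  have h3 : (c * N) ^ 2 ≤ 2 * (a ^ 2 * μ₁ + b ^ 2 * μ₂) * N := by
    have h4 : (c * N) ^ 2 ≤ (a * α₁ + b * α₂) ^ 2 := by gcongr
    have h5 := mul_le_mul_of_nonneg_left h₁ (sq_nonneg a)
    have h6 := mul_le_mul_of_nonneg_left h₂ (sq_nonneg b)
    nlinarith [sq_nonneg (a * α₁ - b * α₂)]
  have h7 : c ^ 2 * N ≤ 2 * (a ^ 2 * μ₁ + b ^ 2 * μ₂) := by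
    refine le_of_mul_le_mul_right ?_ hN
    linarith [show (c * N) ^ 2 = c ^ 2 * N * N by ring]
  rw [div_mul_eq_mul_div, le_div_iff₀ (by positivity)]
  linarith

/-- The error bound for a fixed realization `ξ` of the noise. -/
lemma Assumptions.error_bound (hD : D.Assumptions s₀ β ℓ) :
    ∃ C : ℝ, 0 < C ∧ ∀ θ₁ ∈ Set.Icc (0 : ℝ) 1, ∀ θ₂ ∈ Set.Icc (0 : ℝ) 1,
      ∀ n lam κ : ℝ, 0 < n → 0 < lam → 0 ≤ κ → ∀ (ξ : ℕ → ℝ) (u m : H),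
        D.MemX 1 (D.coeff u) →
        D.scaleNorm (2 * β - 2 * ℓ - eta β ℓ θ₁) ξ ≤ ENNReal.ofReal κ →
        D.scaleNorm (2 - eta β ℓ θ₂) (D.coeff u) ≤ ENNReal.ofReal κ →
        D.IsPosteriorMean β ℓ lam (D.data u n ξ) m →
        ∀ θ ∈ Set.Icc (0 : ℝ) 1, D.scaleNorm (eta β ℓ θ) (D.coeff (m - u)) ^ 2 ≤
          ENNReal.ofReal (C * (lam ^ (-θ) * (n⁻¹ * lam ^ (-θ₁) + lam ^ 2 * lam ^ (-θ₂))) *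
            κ ^ 2) := by
  obtain ⟨K, hK, c, hc, hKc⟩ := hD.exists_whitened
  obtain ⟨c₄, hc₄, h₄⟩ := hD.exists_ext
  obtain ⟨T, -, hT⟩ := h₄ 1 hD.p_lt_one.le le_rfl
  have hp := hD.p_lt_one.le
  have hc₀ : 0 < min (c ^ 2) 1 := lt_min (by positivity) one_pos
  refine ⟨2 / min (c ^ 2) 1 ^ 2 * (c₄ ^ 2 + 1), by positivity, ?_⟩
  intro θ₁ hθ₁ θ₂ hθ₂ n lam κ hn hlam hκ ξ u m hu hξκ huκ hm θ hθ
  obtain ⟨hpη₁, hη₁⟩ := eta_mem hp hθ₁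
  obtain ⟨-, hη₂⟩ := eta_mem hp hθ₂
  obtain ⟨-, hη⟩ := eta_mem hp hθ
  rw [← eta] at hpη₁ hη₁ hη₂ hη
  -- the noise
  obtain ⟨g, hg⟩ := MemX.exists_elt (D := D) (hξκ.trans_lt ENNReal.ofReal_lt_top)
  obtain ⟨T₁, hT₁c, hT₁⟩ := h₄ (eta β ℓ θ₁) hpη₁ hη₁
  have hgκ : ‖g‖ ≤ κ := by
    rw [← hg, scaleNorm_elt, ← ofReal_norm] at hξκ
    exact (ENNReal.ofReal_le_ofReal_iff hκ).1 hξκ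
  have hq : 2 * β - 2 * ℓ - 1 ≤ 2 * β - 2 * ℓ - eta β ℓ θ₁ := by linarith
  obtain ⟨hξ, hhξ⟩ : ∃ hξ, D.elt (2 * β - 2 * ℓ - 1) hξ = ξ :=
    ⟨_, by rw [← hg, D.elt_eq_elt_diag hq]⟩
  -- `T` and `T₁` represent the extensions for `η = 1` and `η = η(θ₁)`, which agree at `ξ`. The
  -- factor can then be moved onto the test function, leaving its `η(θ₁)`-norm.
  have hTξ : T hξ = D.diag ((1 - eta β ℓ θ₁) / 2) (T₁ g) := by
    have h1 := ((hT₁ g _).2 rfl).mono hq (neg_le_neg hη₁)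
    rw [hg, ← hhξ, hT] at h1
    apply D.elt_injective (-1)
    rw [h1, D.elt_eq_elt_diag (neg_le_neg hη₁)]
    congr 3
    ring
  -- the truth
  obtain ⟨r, hr, hrv⟩ := hD.exists_isExtValue_Ainv hu
  obtain ⟨hu', hhu'⟩ := hr.1.exists_elt
  rw [← hhu', hT] at hr
  subst hr
  obtain ⟨xu, rfl⟩ := exists_diag_half_eq hu
  obtain ⟨k, hk⟩ := MemX.exists_elt (D := D) (huκ.trans_lt ENNReal.ofReal_lt_top)
  have hkκ : ‖k‖ ≤ κ := by
    rw [← hk, scaleNorm_elt, ← ofReal_norm] at huκ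
    exact (ENNReal.ofReal_le_ofReal_iff hκ).1 huκ
  -- The extra smoothness of the truth: `lam ⟨xu, x⟩` becomes a pairing of `k` with the `η(θ₂)`-norm
  -- of the error.
  have hxu : xu = D.diag ((1 - eta β ℓ θ₂) / 2) k := by
    apply D.elt_injective 1
    rw [← coeff_diag_half, ← hk, D.elt_eq_elt_diag (show 1 ≤ 2 - eta β ℓ θ₂ by linarith)]
    congr 3
    ring
  -- the error equation
  have hdata : D.data (D.diag (1 / 2) xu) n ξ =
      D.elt (2 * β - 2 * ℓ - 1) (hu' + (√n)⁻¹ • hξ) := by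
    rw [data, map_add, map_smul, hhu', hhξ]
  rw [hdata, isPosteriorMean_iff hK hT] at hm
  obtain ⟨xm, rfl, hxm⟩ := hm
  set x := xm - xu with hx
  -- The weak equation tested with the error itself; `hrv` replaces the `A⁻¹ u` part of the data by
  -- `⟨K xu, K x⟩`.
  have henergy : ‖K x‖ ^ 2 + lam * ‖x‖ ^ 2 =
      (√n)⁻¹ * ⟪T₁ g, D.diag ((1 - eta β ℓ θ₁) / 2) x⟫_ℝ -
        lam * ⟪k, D.diag ((1 - eta β ℓ θ₂) / 2) x⟫_ℝ := by
    have h1 := hxm x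
    have h2 := hrv _ (memX_one_diag_half x)
    rw [coeff_diag_half, pairing_elt, hK, hK] at h2
    rw [map_add, map_smul, inner_add_left, real_inner_smul_left, h2, hTξ, inner_diag] at h1
    rw [← inner_diag D _ k, ← hxu, ← real_inner_self_eq_norm_sq, ← real_inner_self_eq_norm_sq]
    have h3 : ⟪K x, K x⟫_ℝ = ⟪K xm, K x⟫_ℝ - ⟪K xu, K x⟫_ℝ := by
      rw [← inner_sub_left, ← map_sub]
    have h4 : ⟪x, x⟫_ℝ = ⟪xm, x⟫_ℝ - ⟪xu, x⟫_ℝ := by rw [← inner_sub_left]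
    rw [h3, h4]
    linarith
  set α : ℝ → ℝ := fun θ => ‖D.diag ((1 - eta β ℓ θ) / 2) x‖ with hα
  set N := ‖D.diag ((1 - (β - 2 * ℓ)) / 2) x‖ ^ 2 + lam * ‖x‖ ^ 2 with hN
  have hN0 : 0 ≤ N := by positivity
  have hαN {θ : ℝ} (hθ : θ ∈ Set.Icc (0 : ℝ) 1) : α θ ^ 2 ≤ lam ^ (-θ) * N := by
    have h1 := D.interpolation hp hθ hlam.le x
    have h2 := mul_le_mul_of_nonneg_left h1 (Real.rpow_nonneg hlam.le (-θ))
    rwa [← mul_assoc, ← Real.rpow_add hlam, neg_add_cancel, Real.rpow_zero, one_mul] at h2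
  have hmain : min (c ^ 2) 1 * N ≤ (√n)⁻¹ * c₄ * κ * α θ₁ + lam * κ * α θ₂ := by
    have h1 : min (c ^ 2) 1 * N ≤ ‖K x‖ ^ 2 + lam * ‖x‖ ^ 2 := by
      rw [hN, mul_add]
      refine add_le_add ?_ ?_
      · calc min (c ^ 2) 1 * ‖D.diag ((1 - (β - 2 * ℓ)) / 2) x‖ ^ 2
            ≤ c ^ 2 * ‖D.diag ((1 - (β - 2 * ℓ)) / 2) x‖ ^ 2 := by
              gcongr
              exact min_le_left _ _
          _ = (c * ‖D.diag ((1 - (β - 2 * ℓ)) / 2) x‖) ^ 2 := by ring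
          _ ≤ ‖K x‖ ^ 2 := by
              gcongr
              exact hKc x
      · exact mul_le_of_le_one_left (by positivity) (min_le_right _ _)
    have h2 : ⟪T₁ g, D.diag ((1 - eta β ℓ θ₁) / 2) x⟫_ℝ ≤ c₄ * κ * α θ₁ :=
      (real_inner_le_norm _ _).trans (mul_le_mul_of_nonneg_right
        ((hT₁c g).trans (mul_le_mul_of_nonneg_left hgκ hc₄.le)) (norm_nonneg _))
    have h3 : -⟪k, D.diag ((1 - eta β ℓ θ₂) / 2) x⟫_ℝ ≤ κ * α θ₂ :=
      (neg_le_abs _).trans ((abs_real_inner_le_norm _ _).trans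
        (mul_le_mul_of_nonneg_right hkκ (norm_nonneg _)))
    have h4 := mul_le_mul_of_nonneg_left h2 (inv_nonneg.2 (Real.sqrt_nonneg n))
    have h5 := mul_le_mul_of_nonneg_left h3 hlam.le
    linarith
  have hNle := le_of_energy hc₀ hN0 hmain (hαN hθ₁) (hαN hθ₂) (Real.rpow_nonneg hlam.le _)
    (Real.rpow_nonneg hlam.le _)
  rw [← map_sub, scaleNorm_coeff_diag_half hη, ← ofReal_norm,
    ← ENNReal.ofReal_pow (norm_nonneg _)]
  refine ENNReal.ofReal_le_ofReal ((hαN hθ).trans ?_)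
  have hpos (t : ℝ) : 0 ≤ lam ^ t := Real.rpow_nonneg hlam.le t
  have hsq : ((√n)⁻¹) ^ 2 = n⁻¹ := by rw [inv_pow, Real.sq_sqrt hn.le]
  have hin : ((√n)⁻¹ * c₄ * κ) ^ 2 * lam ^ (-θ₁) + (lam * κ) ^ 2 * lam ^ (-θ₂) ≤
      (c₄ ^ 2 + 1) * (n⁻¹ * lam ^ (-θ₁) + lam ^ 2 * lam ^ (-θ₂)) * κ ^ 2 := by
    have e1 : ((√n)⁻¹ * c₄ * κ) ^ 2 = n⁻¹ * c₄ ^ 2 * κ ^ 2 := by rw [mul_pow, mul_pow, hsq]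
    rw [e1]
    have h1 : 0 ≤ n⁻¹ * lam ^ (-θ₁) * κ ^ 2 :=
      mul_nonneg (mul_nonneg (inv_nonneg.2 hn.le) (hpos _)) (sq_nonneg _)
    have h2 : 0 ≤ c₄ ^ 2 * (lam ^ 2 * lam ^ (-θ₂) * κ ^ 2) :=
      mul_nonneg (sq_nonneg _) (mul_nonneg (mul_nonneg (sq_nonneg _) (hpos _)) (sq_nonneg _))
    linarith
  calc lam ^ (-θ) * N
      ≤ lam ^ (-θ) * (2 / min (c ^ 2) 1 ^ 2 *
          ((c₄ ^ 2 + 1) * (n⁻¹ * lam ^ (-θ₁) + lam ^ 2 * lam ^ (-θ₂)) * κ ^ 2)) :=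
        mul_le_mul_of_nonneg_left (hNle.trans (mul_le_mul_of_nonneg_left hin (by positivity)))
          (hpos _)
    _ = _ := by ring

/-! ### Measurability -/

variable (D) in
lemma measurable_scaleNorm (t : ℝ) : Measurable (D.scaleNorm t) := by
  unfold scaleNorm pow
  refine Measurable.pow_const (Measurable.tsum fun k => ?_) _
  fun_prop

variable (D) in
/-- A random sequence that lies in `X^t` almost surely is the image under `C₀^{t/2}` of a random
element of `H`. -/
lemma exists_aestronglyMeasurable_elt {Ω : Type*} [MeasurableSpace Ω] {P : Measure Ω}
    {ξ : Ω → ℕ → ℝ} (hξ : Measurable ξ) {t : ℝ} (h : ∀ᵐ ω ∂P, D.MemX t (ξ ω)) :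
    ∃ X : Ω → H, AEStronglyMeasurable X P ∧ ∀ᵐ ω ∂P, D.elt t (X ω) = ξ ω := by
  have hex (ω : Ω) : ∃ x, D.MemX t (ξ ω) → D.elt t x = ξ ω := by
    by_cases hω : D.MemX t (ξ ω)
    · exact hω.exists_elt.imp fun _ hx _ => hx
    · exact ⟨0, fun h => absurd h hω⟩
  choose X hX' using hex
  have hX : ∀ᵐ ω ∂P, D.elt t (X ω) = ξ ω := h.mono hX'
  -- Although `X` is chosen pointwise, it is almost surely the limit of its partial sums in the
  -- basis, whose coefficients are measurable in `ξ`.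
  refine ⟨X, ?_, hX⟩
  refine aestronglyMeasurable_of_tendsto_ae atTop
    (f := fun N ω => ∑ k ∈ Finset.range N, D.pow (-t / 2) (ξ ω) k • D.φ k) (fun N => ?_) ?_
  · refine StronglyMeasurable.aestronglyMeasurable ?_
    refine Finset.stronglyMeasurable_fun_sum _ fun k _ => ?_
    refine StronglyMeasurable.smul_const (Measurable.stronglyMeasurable ?_) _
    unfold pow
    fun_prop
  · filter_upwards [hX] with ω hω
    have e : D.pow (-t / 2) (ξ ω) = D.coeff (X ω) := by
      rw [← hω, pow_elt, coeff_eq_elt]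
      congr 2
      ring
    rw [e]
    simpa only [repr_apply] using (D.φ.hasSum_repr (X ω)).tendsto_sum_nat

end Model

/-! ### Balancing the exponents -/

lemma lam_eq {θ₁ θ₂ n : ℝ} (hθ₁ : θ₁ ∈ Set.Icc (0 : ℝ) 1) (hθ₂ : θ₂ ∈ Set.Icc (0 : ℝ) 1)
    (hn : 0 < n) : 1 / (n * tau θ₁ θ₂ n ^ 2) = n ^ (-1 / (θ₁ - θ₂ + 2)) := by
  have hd : θ₁ - θ₂ + 2 ≠ 0 := by linarith [hθ₁.1, hθ₂.2]
  rw [tau, ← Real.rpow_natCast, ← Real.rpow_mul hn.le]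
  nth_rewrite 1 [← Real.rpow_one n]
  rw [← Real.rpow_add hn, one_div, ← Real.rpow_neg hn.le]
  congr 1
  field_simp
  push_cast
  ring

/-- This `lam` solves `n⁻¹ lam^{-θ₁} = lam^{2-θ₂}`, so noise and bias contribute equally; hence the
factor 2. -/
lemma rate_eq {θ θ₁ θ₂ n lam : ℝ} (hθ₁ : θ₁ ∈ Set.Icc (0 : ℝ) 1) (hθ₂ : θ₂ ∈ Set.Icc (0 : ℝ) 1)
    (hn : 0 < n) (hlam : lam = n ^ (-1 / (θ₁ - θ₂ + 2))) :
    lam ^ (-θ) * (n⁻¹ * lam ^ (-θ₁) + lam ^ 2 * lam ^ (-θ₂)) =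
      2 * n ^ ((θ + θ₂ - 2) / (θ₁ - θ₂ + 2)) := by
  have hd : θ₁ - θ₂ + 2 ≠ 0 := by linarith [hθ₁.1, hθ₂.2]
  rw [hlam, ← Real.rpow_natCast, ← Real.rpow_neg_one]
  simp only [← Real.rpow_mul hn.le]
  rw [mul_add, ← Real.rpow_add hn, ← Real.rpow_add hn, ← Real.rpow_add hn, ← Real.rpow_add hn,
    two_mul]
  congr 2 <;>
  · field_simp
    push_cast
    ring

end BayesInv

end

/-! ### Integration over the noise -/

theorem theorem7p1 {H : Type*} [NormedAddCommGroup H] [InnerProductSpace ℝ H] [CompleteSpace H]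
    (D : BayesInv.Model H) (s₀ β ℓ : ℝ) (hD : D.Assumptions s₀ β ℓ)
    {Ω : Type*} [MeasurableSpace Ω] (P : Measure Ω) [IsProbabilityMeasure P]
    (ξ : Ω → ℕ → ℝ) (hξ : D.IsNoise P ξ)
    (u : H) (hu : D.MemX 1 (D.coeff u))
    (θ₁ θ₂ : ℝ) (hθ₁ : θ₁ ∈ Set.Icc (0 : ℝ) 1) (hθ₂ : θ₂ ∈ Set.Icc (0 : ℝ) 1)
    (hκ : ∫⁻ ω, (max (D.scaleNorm (2 * β - 2 * ℓ - BayesInv.eta β ℓ θ₁) (ξ ω))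
      (D.scaleNorm (2 - BayesInv.eta β ℓ θ₂) (D.coeff u))) ^ 2 ∂P < ∞) :
    ∃ c : ℝ, 0 < c ∧ ∀ n lam : ℝ, 0 < n → lam = 1 / (n * BayesInv.tau θ₁ θ₂ n ^ 2) →
      (∀ᵐ ω ∂P, ∃! m : H, D.IsPosteriorMean β ℓ lam (D.data u n (ξ ω)) m) ∧
      ∀ m : Ω → H, (∀ᵐ ω ∂P, D.IsPosteriorMean β ℓ lam (D.data u n (ξ ω)) (m ω)) →
        AEStronglyMeasurable m P ∧
        ∀ θ ∈ Set.Icc (0 : ℝ) 1,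
          ∫⁻ ω, D.scaleNorm (BayesInv.eta β ℓ θ) (D.coeff (m ω - u)) ^ 2 ∂P ≤
            ENNReal.ofReal (c * n ^ ((θ + θ₂ - 2) / (θ₁ - θ₂ + 2))) := by
  obtain ⟨C, hC, hbound⟩ := hD.error_bound
  set κ : Ω → ℝ≥0∞ := fun ω => max (D.scaleNorm (2 * β - 2 * ℓ - BayesInv.eta β ℓ θ₁) (ξ ω))
    (D.scaleNorm (2 - BayesInv.eta β ℓ θ₂) (D.coeff u)) with hκdef
  have hκm : Measurable fun ω => κ ω ^ 2 :=
    (((D.measurable_scaleNorm _).comp hξ.measurable).max measurable_const).pow_const 2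
  have hκtop : ∀ᵐ ω ∂P, κ ω < ∞ := by
    filter_upwards [ae_lt_top hκm hκ.ne] with ω hω
    simpa using hω
  obtain ⟨-, hη₁⟩ := BayesInv.Model.eta_mem hD.p_lt_one.le hθ₁
  rw [← BayesInv.eta] at hη₁
  obtain ⟨X, hXm, hX⟩ := D.exists_aestronglyMeasurable_elt (t := 2 * β - 2 * ℓ - 1)
    hξ.measurable (P := P) <| by
      filter_upwards [hκtop] with ω hω
      exact BayesInv.Model.MemX.mono (by linarith) ((le_max_left _ _).trans_lt hω)
  obtain ⟨r, hr, -⟩ := hD.exists_isExtValue_Ainv hu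
  obtain ⟨hu', hhu'⟩ := hr.1.exists_elt
  set I := ∫⁻ ω, κ ω ^ 2 ∂P with hI
  -- The 2 comes from `rate_eq`; the `+ 1` keeps the constant positive when `I = 0`. Neither `C` nor
  -- `I` depends on `n` or `θ`.
  refine ⟨2 * C * (I.toReal + 1), by positivity, fun n lam hn hlam => ?_⟩
  rw [BayesInv.lam_eq hθ₁ hθ₂ hn] at hlam
  have hlam0 : 0 < lam := hlam ▸ Real.rpow_pos_of_pos hn _
  obtain ⟨M, hM⟩ := hD.exists_solution_operator hlam0
  have hdata : ∀ᵐ ω ∂P, ∀ m, D.IsPosteriorMean β ℓ lam (D.data u n (ξ ω)) m ↔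
      m = M (hu' + (√n)⁻¹ • X ω) := by
    filter_upwards [hX] with ω hω m
    rw [← hM, map_add, map_smul, hhu', hω, BayesInv.Model.data]
  refine ⟨?_, fun m hm => ⟨?_, fun θ hθ => ?_⟩⟩
  · filter_upwards [hdata] with ω hω
    exact ⟨_, (hω _).2 rfl, fun m hm => (hω m).1 hm⟩
  · have h1 : AEStronglyMeasurable (fun ω => M (hu' + (√n)⁻¹ • X ω)) P :=
      M.continuous.comp_aestronglyMeasurable
        (aestronglyMeasurable_const.add (hXm.const_smul _))
    refine h1.congr ?_
    filter_upwards [hdata, hm] with ω hω hmω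
    exact ((hω _).1 hmω).symm
  · set ρ := n ^ ((θ + θ₂ - 2) / (θ₁ - θ₂ + 2)) with hρ
    have hρ0 : 0 ≤ ρ := Real.rpow_nonneg hn.le _
    have hpt : ∀ᵐ ω ∂P, D.scaleNorm (BayesInv.eta β ℓ θ) (D.coeff (m ω - u)) ^ 2 ≤
        ENNReal.ofReal (2 * C * ρ) * κ ω ^ 2 := by
      filter_upwards [hκtop, hm] with ω hω hmω
      have hofReal : ENNReal.ofReal (κ ω).toReal = κ ω := ENNReal.ofReal_toReal hω.ne
      have h1 := hbound θ₁ hθ₁ θ₂ hθ₂ n lam (κ ω).toReal hn hlam0 ENNReal.toReal_nonneg (ξ ω) u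
        (m ω) hu (by rw [hofReal]; exact le_max_left _ _) (by rw [hofReal]; exact le_max_right _ _)
        hmω θ hθ
      rw [BayesInv.rate_eq hθ₁ hθ₂ hn hlam, ENNReal.ofReal_mul (by positivity),
        ENNReal.ofReal_pow ENNReal.toReal_nonneg, hofReal] at h1
      convert h1 using 3
      ring
    calc ∫⁻ ω, D.scaleNorm (BayesInv.eta β ℓ θ) (D.coeff (m ω - u)) ^ 2 ∂P
        ≤ ∫⁻ ω, ENNReal.ofReal (2 * C * ρ) * κ ω ^ 2 ∂P := lintegral_mono_ae hpt
      _ = ENNReal.ofReal (2 * C * ρ) * I := lintegral_const_mul _ hκm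
      _ = ENNReal.ofReal (2 * C * ρ * I.toReal) := by
          rw [ENNReal.ofReal_mul (q := I.toReal) (by positivity), ENNReal.ofReal_toReal hκ.ne]
      _ ≤ ENNReal.ofReal (2 * C * (I.toReal + 1) * ρ) := by
          refine ENNReal.ofReal_le_ofReal ?_
          have : 0 ≤ 2 * C * ρ := by positivity
          linarith
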